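/- For an $m\times r$ integer matrix $M$, let $H\le\mathbb{Z}^m$ be the subgroup of all integer linear combinations of the columns of $M$, and let $e_1,\dots,e_m$ be the standard basis vectors of $\mathbb{Z}^m$. The \emph{standardized abelian Cayley graph} of $M$ is the Cayley graph of $\mathbb{Z}^m/H$ with respect to $S=\{H\pm e_1,\dots,H\pm e_m\}$: its vertices are the elements of $\mathbb{Z}^m/H$, and $x,y$ are adjacent if and only if $x-y\in S$ (so a vertex may be adjacent to itself, i.e. carry a loop). For a graph $X$, $\chi(X)$ is the least number of colors in a coloring of the vertices in which adjacent vertices receive different colors; a graph with loops has no such coloring, and then we put $\chi(X)=\infty$. \textbf{Lemma.} Let $y_{11},y_{21},y_{31},y_{32}$ be integers with $y_{11},y_{21},y_{32}>0$ and $-\frac{y_{32}}{2}\le y_{31}\le 0$, and let $X$ be the standardized abelian Cayley graph of the matrix \[\begin{pmatrix} y_{11} & 0\\ y_{21} & 0\\ y_{31} & y_{32}\end{pmatrix}.\] Then: \begin{enumerate} \item $X$ has loops if and only if $y_{32}=1$. \item $\chi(X)=2$ if and only if $y_{11}+y_{21}+y_{31}$ and $y_{32}$ are both even. \item $\chi(X)=4$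 if and only if $y_{11}=y_{21}=-y_{31}=1$ and $3\nmid y_{32}$ and $y_{32}>1$. \item If none of the three conditions on the right-hand sides of (1), (2), (3) holds, then $\chi(X)=3$. \end{enumerate} -/

import Mathlib

/-- An undirected graph in which loops are permitted (and parallel edges are not):
a symmetric relation on the vertex set. -/
structure LoopGraph (V : Type*) where
  /-- The adjacency relation. -/
  Adj : V → V → Prop
  symm : ∀ v w, Adj v w → Adj w v

namespace LoopGraph

/-- The graph has loops: some vertex is adjacent to itself. -/
def HasLoops {V : Type*} (X : LoopGraph V) : Prop :=
  ∃ v, X.Adj v v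

/-- The graph has a proper colouring with `n` colours: adjacent vertices get different colours.
A vertex with a loop is adjacent to itself, so a graph with loops has no proper colouring. -/
def Colorable {V : Type*} (X : LoopGraph V) (n : ℕ) : Prop :=
  ∃ f : V → Fin n, ∀ v w, X.Adj v w → f v ≠ f w

/-- The chromatic number: the least `n` such that the graph is properly colourable with `n`
colours, and `⊤` if there is no such `n` (in particular if the graph has loops). -/
noncomputable def chromaticNumber {V : Type*} (X : LoopGraph V) : ℕ∞ :=
  ⨅ n : {n : ℕ // X.Colorable n}, ((n : ℕ) : ℕ∞)

/-- The Cayley graph of an additive group with respect to a symmetric set `S`: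
`x` and `y` are adjacent when `x - y ∈ S`. It has loops when `0 ∈ S`. -/
def cayley {G : Type*} [AddGroup G] (S : Set G) (hS : ∀ s ∈ S, -s ∈ S) : LoopGraph G where
  Adj x y := x - y ∈ S
  symm x y h := by simpa using hS _ h

end LoopGraph

namespace Heuberger

/-- The subgroup `H` of `ℤ ^ m` of all integer linear combinations of the columns of `M`. -/
def columnSpan {m r : ℕ} (M : Matrix (Fin m) (Fin r) ℤ) : AddSubgroup (Fin m → ℤ) :=
  AddSubgroup.closure (Set.range fun k : Fin r => fun i : Fin m => M i k)

/-- The set `{H ± e₁, …, H ± eₘ}` in `ℤ ^ m / H`. -/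
def generators {m r : ℕ} (M : Matrix (Fin m) (Fin r) ℤ) :
    Set ((Fin m → ℤ) ⧸ columnSpan M) :=
  {g | ∃ j : Fin m, g = QuotientAddGroup.mk (Pi.single j (1 : ℤ)) ∨
    g = QuotientAddGroup.mk (-Pi.single j (1 : ℤ))}

theorem neg_mem_generators {m r : ℕ} (M : Matrix (Fin m) (Fin r) ℤ) :
    ∀ s ∈ generators M, -s ∈ generators M := by
  rintro s ⟨j, rfl | rfl⟩
  · exact ⟨j, Or.inr rfl⟩
  · exact ⟨j, Or.inl (by rw [← QuotientAddGroup.mk_neg, neg_neg])⟩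

/-- The standardized abelian Cayley graph with associated Heuberger matrix `M`: the Cayley graph
of `ℤ ^ m / H` with respect to `{H ± e₁, …, H ± eₘ}`. -/
def sacg {m r : ℕ} (M : Matrix (Fin m) (Fin r) ℤ) :
    LoopGraph ((Fin m → ℤ) ⧸ columnSpan M) :=
  LoopGraph.cayley (generators M) (neg_mem_generators M)

end Heuberger

/-! A proper colouring of the quotient graph is a proper colouring of `ℤ ^ 3` periodic along both
columns, so each part asks which periods are possible.

With two colours, every unit step flips the colour, so each column must have even sum.

With three colours, take `v 0 + v 1 + v 2 + ⌊L v⌋` mod 3 for a linear form `L` with slopes in `[0,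
1]`: unit steps change it by 1 or 2. If `L` has integer values `Q`, `P` on the columns, periodicity
becomes two congruences mod 3 (`colorable_three_of_slopes`). They are solvable except in the family
of part (3), where triangles sharing an edge force the period `3 e₂` (coordinates counted from 0),
and an explicit 4-colouring exists.

Every graph with `1 < n` is thus 3- or 4-colourable, hence loopless. -/

namespace LoopGraph

variable {V : Type*} {X : LoopGraph V}

theorem Colorable.mono {k l : ℕ} (h : k ≤ l) (hX : X.Colorable k) : X.Colorable l := by
  obtain ⟨f, hf⟩ := hX
  exact ⟨fun v => Fin.castLE h (f v), fun v w hvw he => hf v w hvw (Fin.castLE_injective h he)⟩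

theorem Colorable.not_hasLoops {k : ℕ} (hX : X.Colorable k) : ¬ X.HasLoops := by
  rintro ⟨v, hv⟩
  obtain ⟨f, hf⟩ := hX
  exact hf v v hv rfl

theorem chromaticNumber_le_iff {k : ℕ} : X.chromaticNumber ≤ k ↔ X.Colorable k := by
  constructor
  · intro h
    have hlt : X.chromaticNumber < ((k + 1 : ℕ) : ℕ∞) :=
      lt_of_le_of_lt h (by exact_mod_cast Nat.lt_succ_self k)
    obtain ⟨⟨l, hl⟩, hlk⟩ := iInf_lt_iff.1 hlt
    exact hl.mono (Nat.lt_succ_iff.1 (by exact_mod_cast hlk))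
  · intro h
    exact iInf_le (fun n : {n : ℕ // X.Colorable n} => ((n : ℕ) : ℕ∞)) ⟨k, h⟩

theorem chromaticNumber_eq_succ_iff {k : ℕ} :
    X.chromaticNumber = ((k + 1 : ℕ) : ℕ∞) ↔ X.Colorable (k + 1) ∧ ¬ X.Colorable k := by
  rw [← chromaticNumber_le_iff, ← chromaticNumber_le_iff, not_le]
  constructor
  · intro h
    rw [h]
    exact ⟨le_rfl, by exact_mod_cast Nat.lt_succ_self k⟩
  · rintro ⟨h₁, h₂⟩
    refine le_antisymm h₁ ?_
    have := Order.add_one_le_of_lt h₂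
    exact_mod_cast this

end LoopGraph

namespace Heuberger

/-- Proper colourings of `sacg M` are the proper colourings of the integer lattice that are
periodic along the columns of `M`. -/
theorem sacg_colorable_iff {m r : ℕ} (M : Matrix (Fin m) (Fin r) ℤ) (k : ℕ) :
    (sacg M).Colorable k ↔ ∃ F : (Fin m → ℤ) → Fin k,
      (∀ j, Function.Periodic F fun i => M i j) ∧ ∀ i v, F (v + Pi.single i 1) ≠ F v := by
  constructor
  · rintro ⟨f, hf⟩
    refine ⟨fun v => f (QuotientAddGroup.mk v), fun j v => ?_, fun i v => ?_⟩
    · refine congrArg f (QuotientAddGroup.eq.2 ?_)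
      rw [show -(v + fun i => M i j) + v = -(fun i => M i j) by abel]
      exact neg_mem (AddSubgroup.subset_closure ⟨j, rfl⟩)
    · refine hf _ _ ⟨i, Or.inl ?_⟩
      rw [← QuotientAddGroup.mk_sub, add_sub_cancel_left]
  · rintro ⟨F, hper, hF⟩
    have hH : ∀ h ∈ columnSpan M, Function.Periodic F h := by
      intro h hh
      induction hh using AddSubgroup.closure_induction with
      | mem x hx => obtain ⟨j, rfl⟩ := hx; exact hper j
      | zero => intro v; rw [add_zero]
      | add x y _ _ hx hy => exact hx.add_period hy
      | neg x _ hx => exact hx.neg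
    refine ⟨fun g => Quotient.liftOn' g F fun v w hvw => ?_, ?_⟩
    · have h := hH _ (QuotientAddGroup.leftRel_apply.1 hvw) v
      rw [add_neg_cancel_left] at h
      exact h.symm
    · intro v w
      induction v using QuotientAddGroup.induction_on with | H v =>
      induction w using QuotientAddGroup.induction_on with | H w =>
      rintro ⟨i, h | h⟩
      · rw [← QuotientAddGroup.mk_sub] at h
        intro he
        change F v = F w at he
        apply hF i w
        have h2 := hH _ (QuotientAddGroup.eq.1 h) v
        rw [show v + (-(v - w) + Pi.single i 1) = w + Pi.single i 1 by abel] at h2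
        rw [h2, he]
      · rw [← QuotientAddGroup.mk_sub] at h
        have h2 := hH _ (QuotientAddGroup.eq.1 h) (v + Pi.single i 1)
        rw [show v + Pi.single i 1 + (-(v - w) + -Pi.single i 1) = w by abel] at h2
        intro he
        change F v = F w at he
        exact hF i v (by rw [← h2, he])

theorem sacg_colorable_of_int {m r : ℕ} (M : Matrix (Fin m) (Fin r) ℤ) (k : ℕ) [NeZero k]
    (F : (Fin m → ℤ) → ℤ) (hper : ∀ j v, (k : ℤ) ∣ F (v + fun i => M i j) - F v)
    (hF : ∀ i v, ¬ (k : ℤ) ∣ F (v + Pi.single i 1) - F v) : (sacg M).Colorable k := by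
  refine (sacg_colorable_iff M k).2
    ⟨fun v => (ZMod.finEquiv k).symm (F v : ZMod k), fun j v => ?_, fun i v h => hF i v ?_⟩
  · refine congrArg _ (sub_eq_zero.1 ?_)
    rw [← Int.cast_sub]
    exact (ZMod.intCast_zmod_eq_zero_iff_dvd _ k).2 (hper j v)
  · have h := sub_eq_zero.2 ((ZMod.finEquiv k).symm.injective h)
    rw [← Int.cast_sub] at h
    exact (ZMod.intCast_zmod_eq_zero_iff_dvd _ k).1 h

theorem ediv_add_step {t A D : ℤ} (hD : 0 < D) (h₀ : 0 ≤ A) (h₁ : A ≤ D) :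
    (t + A) / D - t / D = 0 ∨ (t + A) / D - t / D = 1 := by
  have h := Int.ediv_le_ediv hD (show t ≤ t + A by linarith)
  have h' := Int.ediv_le_ediv hD (show t + A ≤ t + 1 * D by linarith)
  rw [Int.add_mul_ediv_right _ _ hD.ne'] at h'
  omega

variable {a b c n : ℤ}

theorem not_colorable_one : ¬ (sacg !![a, 0; b, 0; c, n]).Colorable 1 := by
  rw [sacg_colorable_iff]
  rintro ⟨F, -, hF⟩
  exact hF 0 0 (Subsingleton.elim _ _)

theorem colorable_two_iff :
    (sacg !![a, 0; b, 0; c, n]).Colorable 2 ↔ Even (a + b + c) ∧ Even n := by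
  constructor
  · intro h
    obtain ⟨F, hper, hF⟩ : ∃ F : (Fin 3 → ℤ) → ZMod 2,
        (∀ j, Function.Periodic F fun i => !![a, 0; b, 0; c, n] i j) ∧
        ∀ i v, F (v + Pi.single i 1) ≠ F v := (sacg_colorable_iff _ 2).1 h
    -- Two colours leave no choice: `F` is the coordinate sum mod 2 up to the constant `D`.
    let D : (Fin 3 → ℤ) → ZMod 2 := fun v => F v - ((v 0 + v 1 + v 2 : ℤ) : ZMod 2)
    have step : ∀ x y : ZMod 2, x ≠ y → x = y + 1 := by decide
    have hD : ∀ i, Function.Periodic D (Pi.single i 1) := by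
      intro i v
      have h : F (v + Pi.single i 1) = F v + 1 := step _ _ (hF i v)
      simp only [D, h]
      fin_cases i <;> simp <;> ring
    have hconst : ∀ v, D v = D 0 := by
      intro v
      have h := ((((hD 0).zsmul (v 0)).add_period ((hD 1).zsmul (v 1))).add_period
        ((hD 2).zsmul (v 2))) 0
      rw [← h]
      congr 1
      ext i
      fin_cases i <;> simp
    have key : ∀ j : Fin 2, Even (∑ i, !![a, 0; b, 0; c, n] i j) := by
      intro j
      have h₁ := hconst (fun i => !![a, 0; b, 0; c, n] i j)
      have h₂ := hper j 0
      rw [zero_add] at h₂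
      simp only [D, h₂, sub_right_inj] at h₁
      rw [Fin.sum_univ_three, ← ZMod.intCast_eq_zero_iff_even, h₁]
      simp
    have k₀ := key 0
    have k₁ := key 1
    simp [Fin.sum_univ_three] at k₀ k₁
    exact ⟨k₀, k₁⟩
  · rintro ⟨h₁, h₂⟩
    refine sacg_colorable_of_int _ 2 (fun v : Fin 3 → ℤ => v 0 + v 1 + v 2) ?_ ?_
    · intro j v
      fin_cases j <;> simp <;> grind
    · intro i v
      fin_cases i <;> simp

/-- `L` has slope `P / n` on the last coordinate and `(n * Q - c * P) / (n * (a + b))` on the first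
two, the values giving `L = Q` and `L = P` on the columns. The inequalities keep both slopes in `[0,
1]`. -/
theorem colorable_three_of_slopes {P Q : ℤ} (hn : 0 < n) (hs : 0 < a + b)
    (hP₀ : 0 ≤ P) (hP : P ≤ n) (hPn : 3 ∣ n + P) (hQ₀ : c * P ≤ n * Q)
    (hQ : n * Q ≤ (a + b) * n + c * P) (hQs : 3 ∣ a + b + c + Q) :
    (sacg !![a, 0; b, 0; c, n]).Colorable 3 := by
  have hD : 0 < n * (a + b) := mul_pos hn hs
  have hA₀ : 0 ≤ n * Q - c * P := by linarith
  have hA : n * Q - c * P ≤ n * (a + b) := by linarith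
  have hC₀ : 0 ≤ P * (a + b) := by positivity
  have hC : P * (a + b) ≤ n * (a + b) := by gcongr
  refine sacg_colorable_of_int _ 3 (fun v : Fin 3 → ℤ => v 0 + v 1 + v 2 +
    ((n * Q - c * P) * (v 0 + v 1) + P * (a + b) * v 2) / (n * (a + b))) ?_ ?_
  · intro j v
    fin_cases j
    · have h : (n * Q - c * P) * (v 0 + a + (v 1 + b)) + P * (a + b) * (v 2 + c) =
        (n * Q - c * P) * (v 0 + v 1) + P * (a + b) * v 2 + Q * (n * (a + b)) := by ring
      simp [h, Int.add_mul_ediv_right _ _ hD.ne']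
      grind
    · have h : (n * Q - c * P) * (v 0 + v 1) + P * (a + b) * (v 2 + n) =
        (n * Q - c * P) * (v 0 + v 1) + P * (a + b) * v 2 + P * (n * (a + b)) := by ring
      simp [h, Int.add_mul_ediv_right _ _ hD.ne']
      grind
  · intro i v
    have e₁ := ediv_add_step (t := (n * Q - c * P) * (v 0 + v 1) + P * (a + b) * v 2) hD hA₀ hA
    have e₂ := ediv_add_step (t := (n * Q - c * P) * (v 0 + v 1) + P * (a + b) * v 2) hD hC₀ hC
    fin_cases i
    · have h : (n * Q - c * P) * (v 0 + 1 + v 1) + P * (a + b) * v 2 =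
        (n * Q - c * P) * (v 0 + v 1) + P * (a + b) * v 2 + (n * Q - c * P) := by ring
      simp [h]
      omega
    · have h : (n * Q - c * P) * (v 0 + (v 1 + 1)) + P * (a + b) * v 2 =
        (n * Q - c * P) * (v 0 + v 1) + P * (a + b) * v 2 + (n * Q - c * P) := by ring
      simp [h]
      omega
    · have h : (n * Q - c * P) * (v 0 + v 1) + P * (a + b) * (v 2 + 1) =
        (n * Q - c * P) * (v 0 + v 1) + P * (a + b) * v 2 + P * (a + b) := by ring
      simp [h]
      omega

theorem colorable_three (ha : 0 < a) (hb : 0 < b) (hn : 1 < n) (hc : c ≤ 0) (hcn : -n ≤ 2 * c)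
    (h : ¬ (a = 1 ∧ b = 1 ∧ -c = 1 ∧ ¬ 3 ∣ n)) : (sacg !![a, 0; b, 0; c, n]).Colorable 3 := by
  have hn₀ : 0 < n := by omega
  have hs : 0 < a + b := by omega
  -- As `P ≤ 2` and `-n ≤ 2 * c`, the quotient `c * P / n` lies in `[-1, 0]`; `Q` may range over an
  -- interval of length `a + b` starting there.
  obtain ⟨P, hP₀, hP₂, hPn⟩ : ∃ P : ℤ, 0 ≤ P ∧ P ≤ 2 ∧ 3 ∣ n + P := ⟨(-n) % 3, by omega⟩
  have hcP : -n ≤ c * P := by nlinarith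
  have hcP' : c * P ≤ 0 := mul_nonpos_of_nonpos_of_nonneg hc hP₀
  by_cases hs3 : 3 ≤ a + b
  -- `-((-(c * P)) / n)` is the ceiling of `c * P / n`; the three integers from it on fit in the
  -- interval and cover all residues mod 3.
  · obtain ⟨Q, hQ₀, hQ₂, hQs⟩ : ∃ Q : ℤ, -((-(c * P)) / n) ≤ Q ∧ Q ≤ -((-(c * P)) / n) + 2 ∧
        3 ∣ a + b + c + Q :=
      ⟨-((-(c * P)) / n) + (-(a + b + c) + (-(c * P)) / n) % 3, by omega⟩
    have d₁ := Int.mul_ediv_add_emod (-(c * P)) n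
    have d₂ := Int.emod_nonneg (-(c * P)) hn₀.ne'
    have d₃ := Int.emod_lt_of_pos (-(c * P)) hn₀
    refine colorable_three_of_slopes hn₀ hs hP₀ (by omega) hPn ?_ ?_ hQs
    · nlinarith
    · nlinarith
  -- Now the interval has length 2 and is only sure to contain 0 and 1. For `c % 3 = 2`, `Q` must be
  -- 2 or -1, which needs another `P`.
  · obtain ⟨rfl, rfl⟩ : a = 1 ∧ b = 1 := by omega
    obtain h3 | h3 | h3 : c % 3 = 0 ∨ c % 3 = 1 ∨ c % 3 = 2 := by omega
    · exact colorable_three_of_slopes (Q := 1) hn₀ hs hP₀ (by omega) hPn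
        (by linarith) (by linarith) (by omega)
    · exact colorable_three_of_slopes (Q := 0) hn₀ hs hP₀ (by omega) hPn
        (by linarith) (by linarith) (by omega)
    · by_cases hn3 : 3 ∣ n
      · exact colorable_three_of_slopes (P := 0) (Q := 2) hn₀ hs le_rfl (by omega) (by omega)
          (by linarith) (by linarith) (by omega)
      · have hc4 : c ≤ -4 := by omega
        -- `Q = -1` requires `n ≤ -c * R ≤ 3 * n`; `c ≤ -4` leaves room for three consecutive `R`,
        -- all at most `n`.
        obtain ⟨R, hR₀, hR₂, hRn⟩ : ∃ R : ℤ, n / (-c) + 1 ≤ R ∧ R ≤ n / (-c) + 3 ∧ 3 ∣ n + R :=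
          ⟨n / (-c) + 1 + (-(n + n / (-c) + 1)) % 3, by omega⟩
        have d₁ := Int.mul_ediv_add_emod n (-c)
        have d₂ := Int.emod_nonneg n (show -c ≠ 0 by omega)
        have d₃ := Int.emod_lt_of_pos n (show 0 < -c by omega)
        have d₄ : 0 ≤ n / (-c) := Int.ediv_nonneg hn₀.le (by omega)
        have u₁ : n ≤ -c * R := by nlinarith
        have u₂ : -c * R ≤ 3 * n := by nlinarith
        exact colorable_three_of_slopes (Q := -1) hn₀ hs (by omega : 0 ≤ R) (by nlinarith) hRn
          (by linarith) (by linarith) (by omega)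

/-- `v 0 - v 1` and `v 1 + v 2` are invariant under the first column, so only the second needs a
correction by a floor. -/
theorem colorable_four (hn : 1 < n) : (sacg !![1, 0; 1, 0; -1, n]).Colorable 4 := by
  have hn₀ : 0 < n := by omega
  obtain ⟨P, hP₀, hP₂, hPn⟩ : ∃ P : ℤ, 0 ≤ P ∧ P ≤ 2 ∧ 4 ∣ 2 * n + P :=
    ⟨(-(2 * n)) % 4, by omega⟩
  refine sacg_colorable_of_int _ 4
    (fun v : Fin 3 → ℤ => v 0 - v 1 + 2 * (v 1 + v 2) + P * (v 1 + v 2) / n) ?_ ?_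
  · intro j v
    fin_cases j
    · have h : v 1 + 1 + (v 2 + -1) = v 1 + v 2 := by ring
      simp [h]
    · have h : P * (v 1 + (v 2 + n)) = P * (v 1 + v 2) + P * n := by ring
      simp [h, Int.add_mul_ediv_right _ _ hn₀.ne']
      grind
  · intro i v
    have e := ediv_add_step (t := P * (v 1 + v 2)) hn₀ hP₀ (by omega)
    fin_cases i
    · simp
    · have h : P * (v 1 + 1 + v 2) = P * (v 1 + v 2) + P := by ring
      simp [h]
      omega
    · have h : P * (v 1 + (v 2 + 1)) = P * (v 1 + v 2) + P := by ring
      simp [h]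
      omega

/-- Modulo the first column `e₀ + e₁ = e₂`, so `v`, `v + e₀`, `v + e₂` form a triangle. The vertex
`v + e₀ + e₂` is adjacent to the last two, so it has the colour of `v`; likewise with `e₁`. -/
theorem not_colorable_three (hn : ¬ 3 ∣ n) : ¬ (sacg !![1, 0; 1, 0; -1, n]).Colorable 3 := by
  rw [sacg_colorable_iff]
  rintro ⟨F, hper, hF⟩
  have third : ∀ x y z w : Fin 3, x ≠ y → y ≠ z → z ≠ x → w ≠ y → w ≠ z → w = x := by decide
  have hrel : ∀ v : Fin 3 → ℤ, F (v + Pi.single 0 1 + Pi.single 1 1) = F (v + Pi.single 2 1) := by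
    intro v
    rw [← hper 0 (v + Pi.single 2 1)]
    congr 1
    ext i
    fin_cases i <;> simp
  have hrel' : ∀ v : Fin 3 → ℤ, F (v + Pi.single 1 1 + Pi.single 0 1) = F (v + Pi.single 2 1) := by
    intro v
    rw [add_right_comm, hrel]
  have p₀ : Function.Periodic F (Pi.single 0 1 + Pi.single 2 1) := by
    intro v
    refine third _ (F (v + Pi.single 0 1)) (F (v + Pi.single 2 1)) _ (hF 0 v).symm ?_ (hF 2 v)
      ?_ ?_
    · rw [← hrel]; exact (hF 1 _).symm
    · rw [← add_assoc]; exact hF 2 _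
    · rw [← add_assoc, add_right_comm]; exact hF 0 _
  have p₁ : Function.Periodic F (Pi.single 1 1 + Pi.single 2 1) := by
    intro v
    refine third _ (F (v + Pi.single 1 1)) (F (v + Pi.single 2 1)) _ (hF 1 v).symm ?_ (hF 2 v)
      ?_ ?_
    · rw [← hrel']; exact (hF 0 _).symm
    · rw [← add_assoc]; exact hF 2 _
    · rw [← add_assoc, add_right_comm]; exact hF 1 _
  -- The combined period is `3 e₂`; with `n e₂` and `3 ∤ n` it makes `e₂` a period, against
  -- properness.
  have p₂ := ((p₀.add_period p₁).sub_period (hper 0)).zsmul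
  have p₃ := (hper 1).zsmul
  obtain ⟨k, l, hkl⟩ : ∃ k l : ℤ, 3 * k + n * l = 1 := by
    obtain h | h : n % 3 = 1 ∨ n % 3 = 2 := by omega
    · exact ⟨-(n / 3), 1, by omega⟩
    · exact ⟨n / 3 + 1, -1, by omega⟩
  apply hF 2 0
  rw [← (p₂ k).add_period (p₃ l) 0]
  congr 1
  ext i
  simp only [Pi.add_apply, Pi.sub_apply, Pi.smul_apply, Pi.zero_apply]
  fin_cases i <;> simp <;> linarith

theorem hasLoops_of_eq_one (hn : n = 1) : (sacg !![a, 0; b, 0; c, n]).HasLoops := by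
  subst hn
  refine ⟨0, 2, Or.inl ?_⟩
  rw [sub_zero, eq_comm]
  refine (QuotientAddGroup.eq_zero_iff _).2 (AddSubgroup.subset_closure ⟨1, ?_⟩)
  ext i
  fin_cases i <;> simp

end Heuberger

open Heuberger LoopGraph in
theorem mainTheorem9 (y₁₁ y₂₁ y₃₁ y₃₂ : ℤ) (h₁₁ : 0 < y₁₁) (h₂₁ : 0 < y₂₁) (h₃₂ : 0 < y₃₂)
    (hlow : -(y₃₂ : ℚ) / 2 ≤ (y₃₁ : ℚ)) (hup : y₃₁ ≤ 0) :
    ((Heuberger.sacg !![y₁₁, 0; y₂₁, 0; y₃₁, y₃₂]).HasLoops ↔ y₃₂ = 1) ∧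
    ((Heuberger.sacg !![y₁₁, 0; y₂₁, 0; y₃₁, y₃₂]).chromaticNumber = 2 ↔
      Even (y₁₁ + y₂₁ + y₃₁) ∧ Even y₃₂) ∧
    ((Heuberger.sacg !![y₁₁, 0; y₂₁, 0; y₃₁, y₃₂]).chromaticNumber = 4 ↔
      y₁₁ = 1 ∧ y₂₁ = 1 ∧ -y₃₁ = 1 ∧ ¬ (3 ∣ y₃₂) ∧ 1 < y₃₂) ∧
    (¬ (y₃₂ = 1) →
      ¬ (Even (y₁₁ + y₂₁ + y₃₁) ∧ Even y₃₂) →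
      ¬ (y₁₁ = 1 ∧ y₂₁ = 1 ∧ -y₃₁ = 1 ∧ ¬ (3 ∣ y₃₂) ∧ 1 < y₃₂) →
      (Heuberger.sacg !![y₁₁, 0; y₂₁, 0; y₃₁, y₃₂]).chromaticNumber = 3) := by
  have hcn : -y₃₂ ≤ 2 * y₃₁ := by
    have : (-y₃₂ : ℚ) ≤ 2 * y₃₁ := by linarith
    exact_mod_cast this
  have three : 1 < y₃₂ → ¬ (y₁₁ = 1 ∧ y₂₁ = 1 ∧ -y₃₁ = 1 ∧ ¬ (3 ∣ y₃₂) ∧ 1 < y₃₂) →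
      (sacg !![y₁₁, 0; y₂₁, 0; y₃₁, y₃₂]).Colorable 3 := fun hn h =>
    colorable_three h₁₁ h₂₁ hn hup hcn (by tauto)
  have four : 1 < y₃₂ → (y₁₁ = 1 ∧ y₂₁ = 1 ∧ -y₃₁ = 1 ∧ ¬ (3 ∣ y₃₂) ∧ 1 < y₃₂) →
      (sacg !![y₁₁, 0; y₂₁, 0; y₃₁, y₃₂]).Colorable 4 ∧
      ¬ (sacg !![y₁₁, 0; y₂₁, 0; y₃₁, y₃₂]).Colorable 3 := by
    rintro hn ⟨rfl, rfl, hc, h3, -⟩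
    obtain rfl : y₃₁ = -1 := by omega
    exact ⟨colorable_four hn, not_colorable_three h3⟩
  have loops : (sacg !![y₁₁, 0; y₂₁, 0; y₃₁, y₃₂]).HasLoops ↔ y₃₂ = 1 := by
    refine ⟨fun h => ?_, hasLoops_of_eq_one⟩
    by_contra hne
    have hn : 1 < y₃₂ := by omega
    by_cases he : y₁₁ = 1 ∧ y₂₁ = 1 ∧ -y₃₁ = 1 ∧ ¬ (3 ∣ y₃₂) ∧ 1 < y₃₂
    · exact (four hn he).1.not_hasLoops h
    · exact (three hn he).not_hasLoops h
  refine ⟨loops, ?_, ?_, ?_⟩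
  · exact (chromaticNumber_eq_succ_iff (k := 1)).trans
      ((and_iff_left not_colorable_one).trans colorable_two_iff)
  · refine (chromaticNumber_eq_succ_iff (k := 3)).trans ⟨fun ⟨h4, h3⟩ => ?_, fun h => ?_⟩
    · have hn : y₃₂ ≠ 1 := fun h => h4.not_hasLoops (loops.2 h)
      by_contra he
      exact h3 (three (by omega) he)
    · exact four h.2.2.2.2 h
  · intro hn h2 h4
    exact (chromaticNumber_eq_succ_iff (k := 2)).2
      ⟨three (by omega) h4, fun h => h2 (colorable_two_iff.1 h)⟩
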